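/- Let $H$ be a complex Hilbert space, and let $\{U(t)\}_{t\ge 0}$ be a bounded Gibbs semigroup on $H$, that is, a strongly continuous semigroup of bounded operators with $\sup_{t\ge 0}\|U(t)\|<\infty$ such that $U(t)$ is trace class for every $t>0$. Suppose that its generator $X$ (with the sign convention $U(t)=e^{-tX}$) is self-adjoint and positive, i.e. $\langle Xx,x\rangle\ge 0$ for all $x$ in the domain of $X$. For $t>0$ put $F(t)=\|e^{-tX}\|_1$, the trace norm, i.e. the sum of the singular values counted with multiplicity. Let $p>0$ and let $f$ be a function that varies smoothly at infinity with index $p$: $f$ is positive and smooth ($C^\infty$) on $[a,\infty)$ for some $a>0$, and the function $h(x)=\ln f(e^x)$ satisfies $\lim_{x\to\infty}h'(x)=p$ and $\lim_{x\to\infty}h^{(n)}(x)=0$ for all $n\ge 2$. Put $g(t)=f(1/t)$ (which is defined for all small $t>0$). Then $F$ is infinitely differentiable on $(0,\infty)$, and for every integer $n\ge 0$ the derivative $g^{(n)}$ does not vanish on some interval $(0,\varepsilon_n)$, $\varepsilon_n>0$, and: (i) if $F(t)=O(g(t))$ as $t\downarrow 0$, then $F^{(n)}(t)=O(g^{(n)}(t))$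 as $t\downarrow 0$; (ii) if $F(t)\sim g(t)$ as $t\downarrow 0$ (i.e. $F(t)/g(t)\to 1$), then $F^{(n)}(t)\sim g^{(n)}(t)$ as $t\downarrow 0$ (i.e. $F^{(n)}(t)/g^{(n)}(t)\to 1$). -/

import Mathlib

open Filter Topology Asymptotics Set
open scoped ContDiff InnerProductSpace

/-! ### Trace class operators and the trace norm -/

/-- The multiplicity of the number `s > 0` as a singular value of `T`, i.e. the multiplicity of `s ^ 2`
as an eigenvalue of `T* T`. For a compact `T` and `s > 0` the eigenspace is finite dimensional. -/
noncomputable def singularValueMultiplicity {H : Type*} [NormedAddCommGroup H]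
    [InnerProductSpace ℂ H] [CompleteSpace H] (T : H →L[ℂ] H) (s : ℝ) : ℕ :=
  Module.finrank ℂ
    (Module.End.eigenspace ((ContinuousLinearMap.adjoint T ∘L T : H →L[ℂ] H) : H →ₗ[ℂ] H)
      ((s ^ 2 : ℝ) : ℂ))

/-- `T` is trace class: it is compact and its non-zero singular values, counted with
multiplicity, are summable. -/
def IsTraceClass {H : Type*} [NormedAddCommGroup H]
    [InnerProductSpace ℂ H] [CompleteSpace H] (T : H →L[ℂ] H) : Prop :=
  IsCompactOperator T ∧
    Summable fun s : Set.Ioi (0 : ℝ) => (singularValueMultiplicity T s : ℝ) * (s : ℝ)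

/-- The trace norm of a trace class operator: the sum of its non-zero singular values, counted with
multiplicity. -/
noncomputable def traceNorm {H : Type*} [NormedAddCommGroup H]
    [InnerProductSpace ℂ H] [CompleteSpace H] (T : H →L[ℂ] H) : ℝ :=
  ∑' s : Set.Ioi (0 : ℝ), (singularValueMultiplicity T s : ℝ) * (s : ℝ)

/-! ### Semigroups and generators. Only the values `U t` with `0 ≤ t` matter. -/

/-- A strongly continuous one-parameter semigroup of bounded operators. -/
structure IsC0Semigroup {H : Type*} [NormedAddCommGroup H]
    [InnerProductSpace ℂ H] (U : ℝ → H →L[ℂ] H) : Prop where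
  map_zero : U 0 = 1
  map_add : ∀ s t : ℝ, 0 ≤ s → 0 ≤ t → U (s + t) = U s ∘L U t
  tendsto_zero : ∀ x : H, Tendsto (fun t => U t x) (𝓝[>] 0) (𝓝 x)

/-- A Gibbs semigroup: a strongly continuous semigroup of trace class operators (for `t > 0`). -/
structure IsGibbsSemigroup {H : Type*} [NormedAddCommGroup H]
    [InnerProductSpace ℂ H] [CompleteSpace H] (U : ℝ → H →L[ℂ] H) : Prop
    extends IsC0Semigroup U where
  isTraceClass : ∀ t : ℝ, 0 < t → IsTraceClass (U t)

/-- A bounded semigroup: one whose operator norms are uniformly bounded on `[0, ∞)`. -/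
def IsBoundedSemigroup {H : Type*} [NormedAddCommGroup H]
    [InnerProductSpace ℂ H] (U : ℝ → H →L[ℂ] H) : Prop :=
  ∃ M : ℝ, ∀ t : ℝ, 0 ≤ t → ‖U t‖ ≤ M

/-- `X` is the generator of the semigroup `U`, with the sign convention `U t = exp (-t X)`: the
domain of `X` consists of all `x` for which `(x - U t x) / t` converges as `t ↓ 0`, and `X x` is
the limit. -/
structure IsGenerator {H : Type*} [NormedAddCommGroup H]
    [InnerProductSpace ℂ H] (X : H →ₗ.[ℂ] H) (U : ℝ → H →L[ℂ] H) : Prop where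
  mem_domain : ∀ x y : H,
    Tendsto (fun t : ℝ => t⁻¹ • (x - U t x)) (𝓝[>] 0) (𝓝 y) → x ∈ X.domain
  tendsto : ∀ x : X.domain,
    Tendsto (fun t : ℝ => t⁻¹ • ((x : H) - U t (x : H))) (𝓝[>] 0) (𝓝 (X x))

/-! ### Smooth variation -/

/-- `f` varies smoothly at infinity with index `p`: it is positive and smooth on some `[a, ∞)`,
`a > 0`, and `h x = log (f (exp x))` satisfies `h' → p` and `h⁽ⁿ⁾ → 0` for all `n ≥ 2`, as `x → ∞`. -/
structure SmoothlyVarying (f : ℝ → ℝ) (p : ℝ) : Prop where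
  pos_smooth : ∃ a : ℝ, 0 < a ∧ (∀ x ∈ Set.Ici a, 0 < f x) ∧ ContDiffOn ℝ ∞ f (Set.Ici a)
  tendsto_deriv :
    Tendsto (iteratedDeriv 1 fun x => Real.log (f (Real.exp x))) atTop (𝓝 p)
  tendsto_iteratedDeriv : ∀ n : ℕ, 2 ≤ n →
    Tendsto (iteratedDeriv n fun x => Real.log (f (Real.exp x))) atTop (𝓝 0)

/-!
The operators `U t` are symmetric, because for `x`, `y` in the domain of the self-adjoint generator
the function `s ↦ ⟪U (t - s) x, U s y⟫` is constant (`IsGenerator.inner_apply_comm`). An eigenvector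
of one `U t` is then an eigenvector of all of them, with eigenvalues `exp (-a s)`
(`IsC0Semigroup.apply_eq_exp_smul`), so that the singular values of `U t` are the numbers
`exp (-a t)` with multiplicities that do not depend on `t`. Boundedness excludes `a < 0`. No spectral
theorem is needed: the trace norm is a sum over eigenvalues by definition, and
`F t = ∑ w exp (-ℓ t)` with `w, ℓ ≥ 0` (`traceNorm_semigroup_eq_tsum`). Such a series may be
differentiated termwise on `(0, ∞)`, and it is completely monotone.

Put `cₙ = ∏ i < n, -(p + i)`, which is not zero. Smooth variation gives
`tⁿ g⁽ⁿ⁾ t / g t → cₙ`: in the variable `x = -log t` the quotient is a differential polynomial in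
`h'`, and all terms with a higher derivative of `h` vanish in the limit
(`tendsto_iteratedDeriv_div_of_smoothlyVarying`). So it suffices to compare `F⁽ⁿ⁾ t` with `g t / tⁿ`.

If `F = O(g)`, then `ℓⁿ exp (-ℓ t) ≤ n! (2 / t)ⁿ exp (-ℓ t / 2)` bounds `F⁽ⁿ⁾ t` by a multiple of
`F (t / 2) / tⁿ`, and `g (t / 2) = O(g t)` as `g` varies regularly (`isBigO_dirichletDeriv`).
If `F ~ g`, then `tⁿ F⁽ⁿ⁾ t / g t → cₙ` by induction on `n`: since `F⁽ⁿ⁺¹⁾` is monotone, the monotone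
density theorem (`tendsto_mul_deriv_div_of_monotoneOn`) permits differentiating the asymptotics.
-/

/-! ### Self-adjointness of the semigroup -/

section Semigroup

variable {H : Type*} [NormedAddCommGroup H] [InnerProductSpace ℂ H]
  {U : ℝ → H →L[ℂ] H} {M : ℝ}

theorem IsC0Semigroup.apply_add (hU : IsC0Semigroup U) {s t : ℝ} (hs : 0 ≤ s) (ht : 0 ≤ t) (x : H) :
    U (s + t) x = U s (U t x) := by
  rw [hU.map_add s t hs ht]; rfl

theorem IsC0Semigroup.norm_sub_le (hU : IsC0Semigroup U) (hM : ∀ t : ℝ, 0 ≤ t → ‖U t‖ ≤ M)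
    {s t : ℝ} (hs : 0 ≤ s) (ht : 0 ≤ t) (x : H) :
    ‖U t x - U s x‖ ≤ M * ‖U |t - s| x - x‖ := by
  wlog h : s ≤ t generalizing s t
  · rw [norm_sub_rev, abs_sub_comm]
    exact this ht hs (not_le.1 h).le
  have e : U t x - U s x = U s (U |t - s| x - x) := by
    rw [map_sub, ← hU.apply_add hs (abs_nonneg _), abs_of_nonneg (sub_nonneg.2 h)]
    simp
  rw [e]
  exact (U s).le_of_opNorm_le (hM s hs) _

/-- Joint continuity of `(t, x) ↦ U t x` on `[0, ∞) × H`, which holds by uniform boundedness. -/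
theorem IsC0Semigroup.tendsto_apply (hU : IsC0Semigroup U) (hM : ∀ t : ℝ, 0 ≤ t → ‖U t‖ ≤ M)
    {ι : Type*} {l : Filter ι} {r : ι → ℝ} {v : ι → H} {r₀ : ℝ} {v₀ : H}
    (hr : Tendsto r l (𝓝 r₀)) (hr0 : ∀ᶠ i in l, 0 ≤ r i) (hr₀ : 0 ≤ r₀)
    (hv : Tendsto v l (𝓝 v₀)) : Tendsto (fun i => U (r i) (v i)) l (𝓝 (U r₀ v₀)) := by
  have h0 : Tendsto (fun t : ℝ => U |t| v₀) (𝓝 0) (𝓝 v₀) := by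
    have h1 : Tendsto (fun t : ℝ => U t v₀) (𝓝[≥] 0) (𝓝 v₀) := by
      rw [← Ioi_insert, nhdsWithin_insert]
      refine Tendsto.sup ?_ (hU.tendsto_zero v₀)
      rw [tendsto_pure_left]
      intro s hs
      simpa [hU.map_zero] using mem_of_mem_nhds hs
    refine h1.comp (tendsto_nhdsWithin_iff.2 ⟨?_, Eventually.of_forall fun t => abs_nonneg t⟩)
    simpa using (continuous_abs.tendsto (0 : ℝ))
  have h1 : Tendsto (fun i => U |r i - r₀| v₀) l (𝓝 v₀) :=
    h0.comp (by simpa using hr.sub_const r₀)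
  rw [tendsto_iff_norm_sub_tendsto_zero] at h1 hv ⊢
  have h2 : Tendsto (fun i => M * ‖v i - v₀‖ + M * ‖U |r i - r₀| v₀ - v₀‖) l (𝓝 0) := by
    simpa using (hv.const_mul M).add (h1.const_mul M)
  refine squeeze_zero' (Eventually.of_forall fun _ => norm_nonneg _) ?_ h2
  filter_upwards [hr0] with i hi
  calc ‖U (r i) (v i) - U r₀ v₀‖ = ‖U (r i) (v i - v₀) + (U (r i) v₀ - U r₀ v₀)‖ := by
        rw [map_sub]; abel_nf
    _ ≤ _ := norm_add_le _ _
    _ ≤ _ := add_le_add ((U _).le_of_opNorm_le (hM _ hi) _) (hU.norm_sub_le hM hr₀ hi v₀)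

theorem IsC0Semigroup.continuousOn (hU : IsC0Semigroup U) (hM : ∀ t : ℝ, 0 ≤ t → ‖U t‖ ≤ M)
    (x : H) : ContinuousOn (fun t => U t x) (Ici 0) := fun _ ht =>
  hU.tendsto_apply hM (tendsto_id.mono_left nhdsWithin_le_nhds) self_mem_nhdsWithin ht
    tendsto_const_nhds

variable {X : H →ₗ.[ℂ] H}

theorem IsGenerator.hasDerivWithinAt_Ici (hX : IsGenerator X U) (hU : IsC0Semigroup U)
    (x : X.domain) {s : ℝ} (hs : 0 ≤ s) :
    HasDerivWithinAt (fun t => U t (x : H)) (-(U s (X x))) (Ici s) s := by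
  rw [← hasDerivWithinAt_Ioi_iff_Ici, hasDerivWithinAt_iff_tendsto_slope' self_notMem_Ioi]
  have h1 : Tendsto (fun y : ℝ => y - s) (𝓝[>] s) (𝓝[>] 0) := by
    refine tendsto_nhdsWithin_iff.2 ⟨?_, ?_⟩
    · have : Tendsto (fun y : ℝ => y - s) (𝓝 s) (𝓝 (s - s)) := tendsto_id.sub_const s
      rw [sub_self] at this
      exact this.mono_left nhdsWithin_le_nhds
    · filter_upwards [self_mem_nhdsWithin] with y hy using mem_Ioi.2 (sub_pos.2 hy)
  have h2 := (((U s).continuous.tendsto _).comp ((hX.tendsto x).comp h1)).neg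
  refine h2.congr' ?_
  filter_upwards [self_mem_nhdsWithin] with y hy
  have hy' : 0 ≤ y - s := (sub_pos.2 hy).le
  have e : U y (x : H) = U s (U (y - s) x) := by rw [← hU.apply_add hs hy']; simp
  simp only [Function.comp, slope, vsub_eq_sub]
  rw [ContinuousLinearMap.map_smul_of_tower, map_sub, e, ← smul_neg, neg_sub]

theorem IsGenerator.hasDerivWithinAt_Iic (hX : IsGenerator X U) (hU : IsC0Semigroup U)
    (hM : ∀ t : ℝ, 0 ≤ t → ‖U t‖ ≤ M) (x : X.domain) {s : ℝ} (hs : 0 < s) :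
    HasDerivWithinAt (fun t => U t (x : H)) (-(U s (X x))) (Iic s) s := by
  rw [← hasDerivWithinAt_Iio_iff_Iic, hasDerivWithinAt_iff_tendsto_slope' self_notMem_Iio]
  have h1 : Tendsto (fun y : ℝ => s - y) (𝓝[<] s) (𝓝[>] 0) := by
    refine tendsto_nhdsWithin_iff.2 ⟨?_, ?_⟩
    · have : Tendsto (fun y : ℝ => s - y) (𝓝 s) (𝓝 (s - s)) := tendsto_id.const_sub s
      rw [sub_self] at this
      exact this.mono_left nhdsWithin_le_nhds
    · filter_upwards [self_mem_nhdsWithin] with y hy using mem_Ioi.2 (sub_pos.2 hy)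
  have hpos : ∀ᶠ y in 𝓝[<] s, (0 : ℝ) ≤ y :=
    (eventually_ge_nhds hs).filter_mono nhdsWithin_le_nhds
  have h2 := (hU.tendsto_apply hM (tendsto_id.mono_left nhdsWithin_le_nhds) hpos hs.le
    ((hX.tendsto x).comp h1)).neg
  refine h2.congr' ?_
  filter_upwards [self_mem_nhdsWithin, hpos] with y hy hy0
  have hy' : 0 ≤ s - y := (sub_pos.2 hy).le
  have e : U s (x : H) = U y (U (s - y) x) := by rw [← hU.apply_add hy0 hy']; simp
  simp only [Function.comp, slope, vsub_eq_sub, id]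
  rw [ContinuousLinearMap.map_smul_of_tower, map_sub, e, ← neg_smul, ← inv_neg, neg_sub]

theorem IsGenerator.apply_mem_domain (hX : IsGenerator X U) (hU : IsC0Semigroup U)
    (x : X.domain) {s : ℝ} (hs : 0 ≤ s) :
    ∃ h : U s (x : H) ∈ X.domain, X ⟨U s (x : H), h⟩ = U s (X x) := by
  have h1 : Tendsto (fun t : ℝ => t⁻¹ • (U s (x : H) - U t (U s (x : H)))) (𝓝[>] 0)
      (𝓝 (U s (X x))) := by
    refine (((U s).continuous.tendsto _).comp (hX.tendsto x)).congr' ?_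
    filter_upwards [self_mem_nhdsWithin] with t ht
    have ht' : 0 ≤ t := le_of_lt ht
    simp only [Function.comp]
    rw [ContinuousLinearMap.map_smul_of_tower, map_sub, ← hU.apply_add hs ht',
      ← hU.apply_add ht' hs, add_comm]
  exact ⟨hX.mem_domain _ _ h1, tendsto_nhds_unique (hX.tendsto ⟨_, hX.mem_domain _ _ h1⟩) h1⟩

/-- A bounded semigroup whose generator is self-adjoint consists of symmetric operators: for
`x`, `y` in the domain the function `s ↦ ⟪U (t - s) x, U s y⟫` is constant on `[0, t]`. -/
theorem IsGenerator.inner_apply_comm [CompleteSpace H] (hX : IsGenerator X U)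
    (hU : IsC0Semigroup U) (hM : ∀ t : ℝ, 0 ≤ t → ‖U t‖ ≤ M) (hsa : IsSelfAdjoint X)
    {t : ℝ} (ht : 0 ≤ t) (x y : H) : ⟪U t x, y⟫_ℂ = ⟪x, U t y⟫_ℂ := by
  have hdense := hsa.dense_domain
  have hsymm : ∀ a b : X.domain, ⟪X a, (b : H)⟫_ℂ = ⟪(a : H), X b⟫_ℂ := by
    have := LinearPMap.adjoint_isFormalAdjoint hdense
    rw [LinearPMap.isSelfAdjoint_def.1 hsa] at this
    exact fun a b => this a b
  have key : ∀ a b : X.domain, ⟪U t (a : H), (b : H)⟫_ℂ = ⟪(a : H), U t b⟫_ℂ := by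
    intro a b
    have hc : ContinuousOn (fun s => ⟪U (t - s) (a : H), U s (b : H)⟫_ℂ) (Icc 0 t) := by
      refine ContinuousOn.inner ?_ ((hU.continuousOn hM _).mono fun s hs => hs.1)
      exact (hU.continuousOn hM (a : H)).comp (by fun_prop) fun s hs => sub_nonneg.2 hs.2
    have hd : ∀ s ∈ Ico 0 t,
        HasDerivWithinAt (fun s => ⟪U (t - s) (a : H), U s (b : H)⟫_ℂ) 0 (Ici s) s := by
      intro s hs
      have h1 := hX.hasDerivWithinAt_Ici hU b hs.1
      have h2 : HasDerivWithinAt (fun s => U (t - s) (a : H)) (U (t - s) (X a)) (Ici s) s := by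
        have h3 := (hX.hasDerivWithinAt_Iic hU hM a (sub_pos.2 hs.2)).scomp s
          (((hasDerivAt_id s).const_sub t).hasDerivWithinAt (s := Ici s))
          (fun r hr => sub_le_sub_left (mem_Ici.1 hr) t)
        simpa [Function.comp_def] using h3
      have h4 := h2.inner ℂ h1
      obtain ⟨ha, ha'⟩ := hX.apply_mem_domain hU a (sub_pos.2 hs.2).le
      obtain ⟨hb, hb'⟩ := hX.apply_mem_domain hU b hs.1
      have h5 := hsymm ⟨_, ha⟩ ⟨_, hb⟩
      rw [ha', hb'] at h5
      simpa [inner_neg_right, h5] using h4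
    have := constant_of_has_deriv_right_zero hc hd t ⟨ht, le_rfl⟩
    simpa [hU.map_zero] using this.symm
  have hcl : ∀ b : X.domain, ⟪U t x, (b : H)⟫_ℂ = ⟪x, U t b⟫_ℂ := fun b =>
    hdense.induction (P := fun a => ⟪U t a, (b : H)⟫_ℂ = ⟪a, U t b⟫_ℂ) (fun a ha => key ⟨a, ha⟩ b)
      (isClosed_eq (by fun_prop) (by fun_prop)) x
  exact hdense.induction (P := fun b => ⟪U t x, b⟫_ℂ = ⟪x, U t b⟫_ℂ) (fun b hb => hcl ⟨b, hb⟩)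
      (isClosed_eq (by fun_prop) (by fun_prop)) y

/-! ### Eigenvectors and the trace norm -/

/-- An eigenvector of `U t` for a positive eigenvalue is one of `U (t / 2)`, since `U (t / 2)` is
positive semidefinite, so that `U (t / 2) + c` is injective for `c > 0`. -/
theorem IsC0Semigroup.apply_half_eq (hU : IsC0Semigroup U)
    (hs : ∀ t : ℝ, 0 ≤ t → ∀ x y : H, ⟪U t x, y⟫_ℂ = ⟪x, U t y⟫_ℂ) {t c : ℝ} (ht : 0 ≤ t)
    (hc : 0 < c) {x : H} (hx : U t x = (c ^ 2) • x) : U (t / 2) x = c • x := by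
  set z := U (t / 2) x - c • x with hz
  have h1 : U (t / 2) z = -(c • z) := by
    have : U t x = U (t / 2) (U (t / 2) x) := by
      rw [← hU.apply_add (by positivity) (by positivity), add_halves]
    rw [hz, map_sub, ← this, hx, ContinuousLinearMap.map_smul_of_tower, smul_sub, smul_smul]
    rw [sq]; abel
  have h2 : ⟪U (t / 2) z, z⟫_ℂ = (‖U (t / 4) z‖ ^ 2 : ℝ) := by
    have : U (t / 2) z = U (t / 4) (U (t / 4) z) := by
      rw [← hU.apply_add (by positivity) (by positivity)]; congr 2; ring
    rw [this, hs _ (by positivity), inner_self_eq_norm_sq_to_K]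
    simp
  have h3 : ⟪U (t / 2) z, z⟫_ℂ = (-(c * ‖z‖ ^ 2) : ℝ) := by
    rw [h1, inner_neg_left, ← Complex.coe_smul c z, inner_smul_left, inner_self_eq_norm_sq_to_K]
    simp
  rw [h2] at h3
  have h4 : ‖U (t / 4) z‖ ^ 2 = -(c * ‖z‖ ^ 2) := by exact_mod_cast h3
  have h5 : c * ‖z‖ ^ 2 = 0 := le_antisymm (by nlinarith [sq_nonneg ‖U (t / 4) z‖]) (by positivity)
  have h6 : z = 0 := by simpa [hc.ne'] using h5
  exact sub_eq_zero.1 h6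

theorem IsC0Semigroup.apply_natCast_mul (hU : IsC0Semigroup U) {t c : ℝ} (ht : 0 ≤ t) {x : H}
    (hx : U t x = c • x) (k : ℕ) : U (k * t) x = c ^ k • x := by
  induction k with
  | zero => simp [hU.map_zero]
  | succ k ih =>
    rw [Nat.cast_succ, add_mul, one_mul, hU.apply_add (by positivity) ht, hx,
      ContinuousLinearMap.map_smul_of_tower, ih, smul_smul, pow_succ']

/-- An eigenvector of a single `U t`, `t > 0`, is an eigenvector of all operators of the semigroup:
this is true for the dyadic multiples of `t`, and the general case follows by continuity. -/
theorem IsC0Semigroup.apply_eq_exp_smul (hU : IsC0Semigroup U)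
    (hM : ∀ t : ℝ, 0 ≤ t → ‖U t‖ ≤ M)
    (hs : ∀ t : ℝ, 0 ≤ t → ∀ x y : H, ⟪U t x, y⟫_ℂ = ⟪x, U t y⟫_ℂ) {t a : ℝ} (ht : 0 < t)
    {x : H} (hx : U t x = Real.exp (a * t) • x) {s : ℝ} (hs0 : 0 ≤ s) :
    U s x = Real.exp (a * s) • x := by
  have h1 : ∀ n : ℕ, U (t / 2 ^ n) x = Real.exp (a * (t / 2 ^ n)) • x := by
    intro n
    induction n with
    | zero => simpa using hx
    | succ n ih =>
      have e : t / 2 ^ (n + 1) = t / 2 ^ n / 2 := by rw [pow_succ, div_div]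
      rw [e]
      refine hU.apply_half_eq hs (by positivity) (Real.exp_pos _) ?_
      rw [ih, ← Real.exp_nat_mul]
      congr 2
      push_cast
      ring
  set r : ℕ → ℝ := fun n => (⌊s / t * 2 ^ n⌋₊ : ℝ) * (t / 2 ^ n) with hr
  have h2 : ∀ n, U (r n) x = Real.exp (a * r n) • x := by
    intro n
    rw [hr, hU.apply_natCast_mul (by positivity) (h1 n), ← Real.exp_nat_mul]
    congr 2
    ring
  have h3 : Tendsto r atTop (𝓝 s) := by
    have h4 := ((tendsto_nat_floor_mul_div_atTop (R := ℝ) (a := s / t) (by positivity)).comp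
      (tendsto_pow_atTop_atTop_of_one_lt (one_lt_two (α := ℝ)))).mul_const t
    rw [div_mul_cancel₀ _ ht.ne'] at h4
    refine h4.congr fun n => ?_
    simp only [hr, Function.comp]
    ring
  have h4 := hU.tendsto_apply hM h3
    (Eventually.of_forall fun n => by simp only [hr]; positivity) hs0 (tendsto_const_nhds (x := x))
  have h5 : Tendsto (fun n => Real.exp (a * r n) • x) atTop (𝓝 (Real.exp (a * s) • x)) :=
    ((Real.continuous_exp.tendsto _).comp (h3.const_mul a)).smul_const x
  exact tendsto_nhds_unique h4 (h5.congr fun n => (h2 n).symm)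

/-- The multiplicity of `a` as an eigenvalue of the generator, read off from the operator
`U 1 = exp (-X)`. -/
noncomputable def generatorMultiplicity (U : ℝ → H →L[ℂ] H) (a : ℝ) : ℕ :=
  Module.finrank ℂ
    (Module.End.eigenspace (U 1 : H →ₗ[ℂ] H) ((Real.exp (-a) : ℝ) : ℂ))

theorem mem_eigenspace_ofReal_iff (T : H →L[ℂ] H) (c : ℝ) (x : H) :
    x ∈ Module.End.eigenspace (T : H →ₗ[ℂ] H) (c : ℂ) ↔ T x = c • x := by
  rw [Module.End.mem_eigenspace_iff, Complex.coe_smul]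
  rfl

theorem singularValueMultiplicity_semigroup [CompleteSpace H] (hU : IsC0Semigroup U)
    (hM : ∀ t : ℝ, 0 ≤ t → ‖U t‖ ≤ M)
    (hs : ∀ t : ℝ, 0 ≤ t → ∀ x y : H, ⟪U t x, y⟫_ℂ = ⟪x, U t y⟫_ℂ) {t : ℝ} (ht : 0 < t) (a : ℝ) :
    singularValueMultiplicity (U t) (Real.exp (-a * t)) = generatorMultiplicity U a := by
  have hadj : ContinuousLinearMap.adjoint (U t) = U t :=
    ((ContinuousLinearMap.eq_adjoint_iff _ _).2 (hs t ht.le)).symm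
  have h2 : (ContinuousLinearMap.adjoint (U t) ∘L U t : H →L[ℂ] H) = U (2 * t) := by
    rw [hadj, two_mul, hU.map_add t t ht.le ht.le]
  have h3 : Real.exp (-a * t) ^ 2 = Real.exp (-a * (2 * t)) := by
    rw [← Real.exp_nat_mul]; congr 1; push_cast; ring
  have h4 : Module.End.eigenspace (U (2 * t) : H →ₗ[ℂ] H) ((Real.exp (-a * (2 * t)) : ℝ) : ℂ) =
      Module.End.eigenspace (U 1 : H →ₗ[ℂ] H) ((Real.exp (-a * 1) : ℝ) : ℂ) := by
    ext x
    rw [mem_eigenspace_ofReal_iff, mem_eigenspace_ofReal_iff]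
    exact ⟨fun h => hU.apply_eq_exp_smul hM hs (by positivity) h zero_le_one,
      fun h => hU.apply_eq_exp_smul hM hs one_pos h (by positivity)⟩
  rw [singularValueMultiplicity, h2, h3, h4, mul_one, generatorMultiplicity]

/-- A bounded semigroup has no exponentially growing eigenvectors. -/
theorem generatorMultiplicity_eq_zero (hU : IsC0Semigroup U)
    (hM : ∀ t : ℝ, 0 ≤ t → ‖U t‖ ≤ M) {a : ℝ} (ha : a < 0) : generatorMultiplicity U a = 0 := by
  rw [generatorMultiplicity]
  suffices h : Module.End.eigenspace (U 1 : H →ₗ[ℂ] H) ((Real.exp (-a) : ℝ) : ℂ) = ⊥ by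
    rw [h, finrank_bot]
  rw [eq_bot_iff]
  intro x hx
  rw [Module.End.mem_eigenspace_iff, Complex.coe_smul] at hx
  by_contra hx0
  have hx0' : 0 < ‖x‖ := norm_pos_iff.2 hx0
  have h1 : ∀ k : ℕ, Real.exp (-a) ^ k ≤ M := by
    intro k
    have h2 := hU.apply_natCast_mul zero_le_one hx k
    have h3 := (U (k * 1)).le_of_opNorm_le (hM _ (by positivity)) x
    rw [h2, norm_smul, norm_pow, Real.norm_eq_abs, Real.abs_exp] at h3
    exact le_of_mul_le_mul_right h3 hx0'
  obtain ⟨k, hk⟩ := pow_unbounded_of_one_lt M (Real.one_lt_exp_iff.2 (neg_pos.2 ha))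
  exact absurd (h1 k) (not_le.2 hk)

/-- The change of variables `a ↦ exp (-a t)` from eigenvalues of the generator to singular values
of `U t`. -/
noncomputable def expNegMulEquiv {t : ℝ} (ht : 0 < t) : ℝ ≃ Ioi (0 : ℝ) :=
  ((Equiv.neg ℝ).trans (Equiv.mulRight₀ t ht.ne')).trans Real.expOrderIso.toEquiv

theorem coe_expNegMulEquiv {t : ℝ} (ht : 0 < t) (a : ℝ) :
    (expNegMulEquiv ht a : ℝ) = Real.exp (-a * t) := rfl

/-- The summand at `a` of the trace series. Negative `a` have multiplicity zero, so `a` may be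
replaced by its positive part. -/
theorem singularValueMultiplicity_mul_expNegMulEquiv [CompleteSpace H] (hU : IsC0Semigroup U)
    (hM : ∀ t : ℝ, 0 ≤ t → ‖U t‖ ≤ M)
    (hs : ∀ t : ℝ, 0 ≤ t → ∀ x y : H, ⟪U t x, y⟫_ℂ = ⟪x, U t y⟫_ℂ) {t : ℝ} (ht : 0 < t) (a : ℝ) :
    (singularValueMultiplicity (U t) (expNegMulEquiv ht a) : ℝ) * (expNegMulEquiv ht a : ℝ) =
      generatorMultiplicity U a * Real.exp (-max a 0 * t) := by
  rw [coe_expNegMulEquiv, singularValueMultiplicity_semigroup hU hM hs ht]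
  rcases lt_or_ge a 0 with ha | ha
  · simp [generatorMultiplicity_eq_zero hU hM ha]
  · rw [max_eq_left ha]

theorem IsTraceClass.summable_generatorMultiplicity [CompleteSpace H] (hU : IsC0Semigroup U)
    (hM : ∀ t : ℝ, 0 ≤ t → ‖U t‖ ≤ M)
    (hs : ∀ t : ℝ, 0 ≤ t → ∀ x y : H, ⟪U t x, y⟫_ℂ = ⟪x, U t y⟫_ℂ) {t : ℝ} (ht : 0 < t)
    (htc : IsTraceClass (U t)) :
    Summable fun a : ℝ => (generatorMultiplicity U a : ℝ) * Real.exp (-max a 0 * t) := by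
  refine ((expNegMulEquiv ht).summable_iff.2 htc.2).congr fun a => ?_
  exact singularValueMultiplicity_mul_expNegMulEquiv hU hM hs ht a

theorem traceNorm_semigroup_eq_tsum [CompleteSpace H] (hU : IsC0Semigroup U)
    (hM : ∀ t : ℝ, 0 ≤ t → ‖U t‖ ≤ M)
    (hs : ∀ t : ℝ, 0 ≤ t → ∀ x y : H, ⟪U t x, y⟫_ℂ = ⟪x, U t y⟫_ℂ) {t : ℝ} (ht : 0 < t) :
    traceNorm (U t) =
      ∑' a : ℝ, (generatorMultiplicity U a : ℝ) * Real.exp (-max a 0 * t) := by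
  rw [traceNorm, ← (expNegMulEquiv ht).tsum_eq]
  exact tsum_congr (singularValueMultiplicity_mul_expNegMulEquiv hU hM hs ht)

end Semigroup

/-! ### Generalized Dirichlet series -/

section Dirichlet

variable {ι : Type*} {w ℓ : ι → ℝ}

/-- The generalized Dirichlet series `∑ w (-ℓ)ⁿ exp (-ℓ t)`, the `n`-th derivative of
`t ↦ ∑ w exp (-ℓ t)`. -/
noncomputable def dirichletDeriv (w ℓ : ι → ℝ) (n : ℕ) (t : ℝ) : ℝ :=
  ∑' i, w i * ((-ℓ i) ^ n * Real.exp (-ℓ i * t))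

/-- Half of the exponential absorbs the powers of `ℓ`: `yⁿ / n! ≤ exp y` with `y = ℓ t / 2`. -/
theorem pow_mul_exp_neg_mul_le {x t : ℝ} (hx : 0 ≤ x) (ht : 0 < t) (n : ℕ) :
    x ^ n * Real.exp (-x * t) ≤ n.factorial * (2 / t) ^ n * Real.exp (-x * (t / 2)) := by
  have h1 := Real.pow_div_factorial_le_exp (x * (t / 2)) (by positivity) n
  rw [div_le_iff₀ (by positivity)] at h1
  have e : Real.exp (-x * (t / 2)) = Real.exp (x * (t / 2)) * Real.exp (-x * t) := by
    rw [← Real.exp_add]; congr 1; ring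
  have e2 : x ^ n = (2 / t) ^ n * (x * (t / 2)) ^ n := by
    rw [← mul_pow]; congr 1; field_simp
  rw [e, e2]
  calc _ ≤ (2 / t) ^ n * (Real.exp (x * (t / 2)) * n.factorial) * Real.exp (-x * t) := by gcongr
    _ = _ := by ring

theorem norm_dirichletDeriv_term_le (hw : ∀ i, 0 ≤ w i) (hℓ : ∀ i, 0 ≤ ℓ i)
    {t : ℝ} (ht : 0 < t) (n : ℕ) (i : ι) :
    ‖w i * ((-ℓ i) ^ n * Real.exp (-ℓ i * t))‖ ≤
      n.factorial * (2 / t) ^ n * (w i * Real.exp (-ℓ i * (t / 2))) := by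
  rw [norm_mul, norm_mul, norm_pow, norm_neg, Real.norm_of_nonneg (hw i),
    Real.norm_of_nonneg (hℓ i), Real.norm_of_nonneg (Real.exp_pos _).le]
  calc _ ≤ w i * (n.factorial * (2 / t) ^ n * Real.exp (-ℓ i * (t / 2))) :=
        mul_le_mul_of_nonneg_left (pow_mul_exp_neg_mul_le (hℓ i) ht n) (hw i)
    _ = _ := by ring

theorem summable_norm_dirichletDeriv (hw : ∀ i, 0 ≤ w i) (hℓ : ∀ i, 0 ≤ ℓ i)
    (hsum : ∀ t : ℝ, 0 < t → Summable fun i => w i * Real.exp (-ℓ i * t))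
    {t : ℝ} (ht : 0 < t) (n : ℕ) :
    Summable fun i => ‖w i * ((-ℓ i) ^ n * Real.exp (-ℓ i * t))‖ :=
  Summable.of_nonneg_of_le (fun _ => norm_nonneg _) (norm_dirichletDeriv_term_le hw hℓ ht n)
    ((hsum (t / 2) (by positivity)).mul_left _)

theorem abs_dirichletDeriv_le (hw : ∀ i, 0 ≤ w i) (hℓ : ∀ i, 0 ≤ ℓ i)
    (hsum : ∀ t : ℝ, 0 < t → Summable fun i => w i * Real.exp (-ℓ i * t))
    {t : ℝ} (ht : 0 < t) (n : ℕ) :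
    |dirichletDeriv w ℓ n t| ≤ n.factorial * (2 / t) ^ n * dirichletDeriv w ℓ 0 (t / 2) := by
  have h1 := norm_tsum_le_tsum_norm (summable_norm_dirichletDeriv hw hℓ hsum ht n)
  have h2 := (summable_norm_dirichletDeriv hw hℓ hsum ht n).tsum_le_tsum
    (norm_dirichletDeriv_term_le hw hℓ ht n) ((hsum (t / 2) (by positivity)).mul_left _)
  rw [tsum_mul_left] at h2
  simpa [dirichletDeriv] using h1.trans h2

theorem hasDerivAt_dirichletDeriv (hw : ∀ i, 0 ≤ w i) (hℓ : ∀ i, 0 ≤ ℓ i)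
    (hsum : ∀ t : ℝ, 0 < t → Summable fun i => w i * Real.exp (-ℓ i * t))
    {t : ℝ} (ht : 0 < t) (n : ℕ) :
    HasDerivAt (dirichletDeriv w ℓ n) (dirichletDeriv w ℓ (n + 1) t) t := by
  have ht2 : 0 < t / 2 := by positivity
  have hmem : t ∈ Ioi (t / 2) := mem_Ioi.2 (half_lt_self ht)
  have hd : ∀ i y, y ∈ Ioi (t / 2) →
      HasDerivAt (fun y => w i * ((-ℓ i) ^ n * Real.exp (-ℓ i * y)))
        (w i * ((-ℓ i) ^ (n + 1) * Real.exp (-ℓ i * y))) y := by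
    intro i y _
    have := ((((hasDerivAt_id y).const_mul (-ℓ i)).exp).const_mul ((-ℓ i) ^ n)).const_mul (w i)
    refine this.congr_deriv ?_
    simp only [id]
    ring
  have hb : ∀ i y, y ∈ Ioi (t / 2) → ‖w i * ((-ℓ i) ^ (n + 1) * Real.exp (-ℓ i * y))‖ ≤
      ‖w i * ((-ℓ i) ^ (n + 1) * Real.exp (-ℓ i * (t / 2)))‖ := by
    intro i y hy
    have h1 : Real.exp (-ℓ i * y) ≤ Real.exp (-ℓ i * (t / 2)) :=
      Real.exp_le_exp.2 (mul_le_mul_of_nonpos_left (mem_Ioi.1 hy).le (neg_nonpos.2 (hℓ i)))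
    rw [norm_mul, norm_mul, norm_mul, norm_mul, Real.norm_of_nonneg (Real.exp_pos _).le,
      Real.norm_of_nonneg (Real.exp_pos _).le]
    exact mul_le_mul_of_nonneg_left (mul_le_mul_of_nonneg_left h1 (norm_nonneg _)) (norm_nonneg _)
  exact hasDerivAt_tsum_of_isPreconnected
    (summable_norm_dirichletDeriv hw hℓ hsum ht2 (n + 1)) isOpen_Ioi isPreconnected_Ioi
    hd hb hmem (summable_norm_dirichletDeriv hw hℓ hsum ht n).of_norm hmem

theorem contDiffOn_dirichletDeriv (hw : ∀ i, 0 ≤ w i) (hℓ : ∀ i, 0 ≤ ℓ i)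
    (hsum : ∀ t : ℝ, 0 < t → Summable fun i => w i * Real.exp (-ℓ i * t)) (n : ℕ) :
    ContDiffOn ℝ ∞ (dirichletDeriv w ℓ n) (Ioi 0) := by
  rw [contDiffOn_infty]
  intro k
  induction k generalizing n with
  | zero =>
    exact contDiffOn_zero.2 fun t ht =>
      (hasDerivAt_dirichletDeriv hw hℓ hsum ht n).continuousAt.continuousWithinAt
  | succ k ih =>
    rw [Nat.cast_succ, contDiffOn_succ_iff_deriv_of_isOpen isOpen_Ioi]
    refine ⟨fun t ht =>
      (hasDerivAt_dirichletDeriv hw hℓ hsum ht n).differentiableAt.differentiableWithinAt,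
      by simp, (ih (n + 1)).congr fun t ht => (hasDerivAt_dirichletDeriv hw hℓ hsum ht n).deriv⟩

/-- The series is completely monotone: the sign of its `n`-th derivative is `(-1)ⁿ`. -/
theorem neg_one_pow_mul_dirichletDeriv_nonneg (hw : ∀ i, 0 ≤ w i) (hℓ : ∀ i, 0 ≤ ℓ i) (n : ℕ)
    (t : ℝ) : 0 ≤ (-1) ^ n * dirichletDeriv w ℓ n t := by
  rw [dirichletDeriv, ← tsum_mul_left]
  refine tsum_nonneg fun i => ?_
  have e : (-1) ^ n * (w i * ((-ℓ i) ^ n * Real.exp (-ℓ i * t))) =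
      w i * (ℓ i ^ n * Real.exp (-ℓ i * t)) := by
    rw [neg_pow (ℓ i) n]
    have : ((-1 : ℝ) ^ n) * (-1) ^ n = 1 := by rw [← mul_pow]; simp
    linear_combination (w i * (ℓ i ^ n * Real.exp (-ℓ i * t))) * this
  rw [e]
  exact mul_nonneg (hw i) (mul_nonneg (pow_nonneg (hℓ i) n) (Real.exp_pos _).le)

theorem iteratedDeriv_eq_dirichletDeriv (hw : ∀ i, 0 ≤ w i) (hℓ : ∀ i, 0 ≤ ℓ i)
    (hsum : ∀ t : ℝ, 0 < t → Summable fun i => w i * Real.exp (-ℓ i * t)) {F : ℝ → ℝ}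
    (hF : ∀ t, 0 < t → F t = dirichletDeriv w ℓ 0 t) (n : ℕ) {t : ℝ} (ht : 0 < t) :
    iteratedDeriv n F t = dirichletDeriv w ℓ n t := by
  induction n generalizing t with
  | zero => simpa using hF t ht
  | succ n ih =>
    have h1 : iteratedDeriv n F =ᶠ[𝓝 t] dirichletDeriv w ℓ n := by
      filter_upwards [Ioi_mem_nhds ht] with s hs using ih hs
    rw [iteratedDeriv_succ, h1.deriv_eq, (hasDerivAt_dirichletDeriv hw hℓ hsum ht n).deriv]

theorem monotoneOn_neg_one_pow_mul_dirichletDeriv (hw : ∀ i, 0 ≤ w i) (hℓ : ∀ i, 0 ≤ ℓ i)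
    (hsum : ∀ t : ℝ, 0 < t → Summable fun i => w i * Real.exp (-ℓ i * t)) (n : ℕ) :
    MonotoneOn (fun t => (-1) ^ n * dirichletDeriv w ℓ (n + 1) t) (Ioi 0) := by
  have hd : ∀ t : ℝ, 0 < t → HasDerivAt (fun t => (-1) ^ n * dirichletDeriv w ℓ (n + 1) t)
      ((-1) ^ n * dirichletDeriv w ℓ (n + 2) t) t := fun t ht =>
    (hasDerivAt_dirichletDeriv hw hℓ hsum ht (n + 1)).const_mul _
  refine monotoneOn_of_deriv_nonneg (convex_Ioi 0)
    (fun t ht => (hd t ht).continuousAt.continuousWithinAt) ?_ ?_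
  · rw [interior_Ioi]
    exact fun t ht => (hd t ht).differentiableAt.differentiableWithinAt
  · rw [interior_Ioi]
    intro t ht
    rw [(hd t ht).deriv]
    simpa [pow_add] using neg_one_pow_mul_dirichletDeriv_nonneg hw hℓ (n + 2) t

end Dirichlet

/-! ### Functions with vanishing derivatives at infinity -/

/-- `u` is smooth near infinity, tends to `c`, and all its derivatives of positive order tend
to `0`. Such functions form a differential algebra. -/
def HasFlatLimit (u : ℝ → ℝ) (c : ℝ) : Prop :=
  (∀ᶠ x in atTop, ContDiffAt ℝ ∞ u x) ∧
    ∀ k : ℕ, Tendsto (iteratedDeriv k u) atTop (𝓝 (if k = 0 then c else 0))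

namespace HasFlatLimit

variable {u v : ℝ → ℝ} {c d : ℝ}

theorem tendsto (hu : HasFlatLimit u c) : Tendsto u atTop (𝓝 c) := by simpa using hu.2 0

theorem const (c : ℝ) : HasFlatLimit (fun _ => c) c := by
  refine ⟨Eventually.of_forall fun x => contDiffAt_const, fun k => ?_⟩
  refine tendsto_const_nhds.congr fun x => ?_
  rw [iteratedDeriv_const]

theorem add (hu : HasFlatLimit u c) (hv : HasFlatLimit v d) :
    HasFlatLimit (fun x => u x + v x) (c + d) := by
  refine ⟨?_, fun k => ?_⟩
  · filter_upwards [hu.1, hv.1] with x hx hy using hx.add hy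
  · have h1 := (hu.2 k).add (hv.2 k)
    have e : (if k = 0 then c else 0) + (if k = 0 then d else 0) = if k = 0 then c + d else 0 := by
      split_ifs <;> simp
    rw [e] at h1
    refine h1.congr' ?_
    filter_upwards [hu.1, hv.1] with x hx hy
    exact (iteratedDeriv_fun_add (hx.of_le (mod_cast le_top)) (hy.of_le (mod_cast le_top))).symm

theorem mul (hu : HasFlatLimit u c) (hv : HasFlatLimit v d) :
    HasFlatLimit (fun x => u x * v x) (c * d) := by
  refine ⟨?_, fun k => ?_⟩
  · filter_upwards [hu.1, hv.1] with x hx hy using hx.mul hy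
  · have h1 := tendsto_finsetSum (Finset.range (k + 1)) fun i _ =>
      ((hu.2 i).const_mul (k.choose i : ℝ)).mul (hv.2 (k - i))
    have e : ∑ i ∈ Finset.range (k + 1), (k.choose i : ℝ) * (if i = 0 then c else 0) *
        (if k - i = 0 then d else 0) = if k = 0 then c * d else 0 := by
      rcases Nat.eq_zero_or_pos k with rfl | hk
      · simp
      · rw [if_neg hk.ne']
        refine Finset.sum_eq_zero fun i _ => ?_
        rcases Nat.eq_zero_or_pos i with rfl | hi
        · simp [hk.ne']
        · simp [hi.ne']
    rw [e] at h1
    refine h1.congr' ?_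
    filter_upwards [hu.1, hv.1] with x hx hy
    exact (iteratedDeriv_fun_mul (hx.of_le (mod_cast le_top)) (hy.of_le (mod_cast le_top))).symm

theorem deriv (hu : HasFlatLimit u c) : HasFlatLimit (deriv u) 0 := by
  refine ⟨?_, fun k => ?_⟩
  · filter_upwards [hu.1] with x hx
    have := hx.derivWithin (m := ∞) (n := ∞) (by simp)
    exact this
  · rw [← iteratedDeriv_succ']
    simpa using hu.2 (k + 1)

end HasFlatLimit

/-! ### Smoothly varying functions -/

namespace SmoothlyVarying

variable {f : ℝ → ℝ} {p : ℝ}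

theorem eventually_pos_contDiffAt (hf : SmoothlyVarying f p) :
    ∀ᶠ x in atTop, 0 < f (Real.exp x) ∧
      ContDiffAt ℝ ∞ (fun x => Real.log (f (Real.exp x))) x := by
  obtain ⟨a, ha, hpos, hsm⟩ := hf.pos_smooth
  filter_upwards [Real.tendsto_exp_atTop.eventually_gt_atTop a] with x hx
  have h1 : 0 < f (Real.exp x) := hpos _ hx.le
  refine ⟨h1, ContDiffAt.log ?_ h1.ne'⟩
  exact (hsm.contDiffAt (Ici_mem_nhds hx)).comp x Real.contDiff_exp.contDiffAt

theorem hasFlatLimit_deriv (hf : SmoothlyVarying f p) :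
    HasFlatLimit (deriv fun x => Real.log (f (Real.exp x))) p := by
  refine ⟨?_, fun k => ?_⟩
  · filter_upwards [hf.eventually_pos_contDiffAt] with x hx
    exact hx.2.derivWithin (m := ∞) (n := ∞) (by simp)
  · rw [← iteratedDeriv_succ']
    rcases Nat.eq_zero_or_pos k with rfl | hk
    · simpa using hf.tendsto_deriv
    · rw [if_neg hk.ne']
      exact hf.tendsto_iteratedDeriv _ (by omega)

/-- Over a translation by `b`, the function `x ↦ log (f (exp x))` grows by `p b` in the limit. -/
theorem tendsto_log_comp_exp_sub (hf : SmoothlyVarying f p) (b : ℝ) :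
    Tendsto (fun x => Real.log (f (Real.exp (x + b))) - Real.log (f (Real.exp x))) atTop
      (𝓝 (p * b)) := by
  set h : ℝ → ℝ := fun x => Real.log (f (Real.exp x)) with hh
  obtain ⟨B, hB⟩ := eventually_atTop.1 hf.eventually_pos_contDiffAt
  have hd : ∀ x, B ≤ x → HasDerivAt h (deriv h x) x := fun x hx =>
    ((hB x hx).2.differentiableAt (by simp)).hasDerivAt
  have hlim : Tendsto (deriv h) atTop (𝓝 p) := hf.hasFlatLimit_deriv.tendsto
  rw [Metric.tendsto_atTop] at hlim ⊢
  intro ε hε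
  obtain ⟨N, hN⟩ := hlim (ε / (|b| + 1)) (by positivity)
  refine ⟨max B N + |b|, fun x hx => ?_⟩
  -- The function `y ↦ h y - p y` is Lipschitz with a small constant on `[max B N, ∞)`.
  have h1 : ‖(h (x + b) - p * (x + b)) - (h x - p * x)‖ ≤ ε / (|b| + 1) * ‖x + b - x‖ := by
    refine (convex_Ici (max B N)).norm_image_sub_le_of_norm_hasDerivWithin_le
      (f := fun y => h y - p * y) (f' := fun y => deriv h y - p) (fun y hy => ?_) (fun y hy => ?_)
      ?_ ?_
    · have := (hd y ((le_max_left _ _).trans hy)).sub ((hasDerivAt_id y).const_mul p)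
      rw [mul_one] at this
      exact this.hasDerivWithinAt
    · exact (hN y ((le_max_right _ _).trans hy)).le
    · exact mem_Ici.2 (by linarith [abs_nonneg b])
    · exact mem_Ici.2 (by linarith [neg_abs_le b])
  have e1 : (h (x + b) - p * (x + b)) - (h x - p * x) = h (x + b) - h x - p * b := by ring
  rw [e1, add_sub_cancel_left, Real.norm_eq_abs b] at h1
  rw [Real.dist_eq]
  refine h1.trans_lt ?_
  rw [div_mul_eq_mul_div, div_lt_iff₀ (by positivity)]
  nlinarith [abs_nonneg b]

end SmoothlyVarying

theorem tendsto_neg_log_nhdsGT_zero : Tendsto (fun t => -Real.log t) (𝓝[>] 0) atTop :=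
  tendsto_neg_atBot_atTop.comp Real.tendsto_log_nhdsGT_zero

section Inversion

variable {f g : ℝ → ℝ} {p : ℝ}

theorem eventually_pos_of_smoothlyVarying (hf : SmoothlyVarying f p)
    (hg : ∀ t : ℝ, 0 < t → g t = f t⁻¹) : ∀ᶠ t in 𝓝[>] (0 : ℝ), 0 < g t := by
  filter_upwards [tendsto_neg_log_nhdsGT_zero.eventually hf.eventually_pos_contDiffAt,
    self_mem_nhdsWithin] with t ht ht0
  have := ht.1
  rwa [Real.exp_neg, Real.exp_log ht0, ← hg t ht0] at this

theorem eventually_eq_exp_of_smoothlyVarying (hf : SmoothlyVarying f p)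
    (hg : ∀ t : ℝ, 0 < t → g t = f t⁻¹) :
    ∀ᶠ t in 𝓝[>] (0 : ℝ), g t = Real.exp (Real.log (f (Real.exp (-Real.log t)))) := by
  filter_upwards [eventually_pos_of_smoothlyVarying hf hg, self_mem_nhdsWithin] with t ht ht0
  rw [Real.exp_neg, Real.exp_log ht0, ← hg t ht0, Real.exp_log ht]

theorem tendsto_mul_nhdsGT_zero {a : ℝ} (ha : 0 < a) :
    Tendsto (fun t => a * t) (𝓝[>] 0) (𝓝[>] 0) := by
  refine tendsto_nhdsWithin_iff.2 ⟨?_, ?_⟩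
  · have : Tendsto (fun t => a * t) (𝓝 0) (𝓝 (a * 0)) := tendsto_id.const_mul a
    rw [mul_zero] at this
    exact this.mono_left nhdsWithin_le_nhds
  · filter_upwards [self_mem_nhdsWithin] with t ht using mul_pos ha ht

/-- `g` varies regularly at `0` with index `-p`. -/
theorem tendsto_div_of_smoothlyVarying (hf : SmoothlyVarying f p)
    (hg : ∀ t : ℝ, 0 < t → g t = f t⁻¹) {a : ℝ} (ha : 0 < a) :
    Tendsto (fun t => g (a * t) / g t) (𝓝[>] 0) (𝓝 (a ^ (-p))) := by
  have h1 := (Real.continuous_exp.tendsto _).comp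
    ((hf.tendsto_log_comp_exp_sub (-Real.log a)).comp tendsto_neg_log_nhdsGT_zero)
  have e : Real.exp (p * -Real.log a) = a ^ (-p) := by
    rw [Real.rpow_def_of_pos ha]; congr 1; ring
  rw [e] at h1
  have h2 := eventually_eq_exp_of_smoothlyVarying hf hg
  refine h1.congr' ?_
  filter_upwards [h2, (tendsto_mul_nhdsGT_zero ha).eventually h2, self_mem_nhdsWithin]
    with t ht hat ht0
  rw [ht, hat, ← Real.exp_sub, Real.log_mul ha.ne' (ne_of_gt ht0), neg_add, add_comm (-Real.log a)]
  rfl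

/-- The functions `uₙ` with `g⁽ⁿ⁾ t = t⁻ⁿ (g t) (uₙ (-log t))` for `g t = exp (h (-log t))`,
where `h'` is the argument. -/
noncomputable def derivFactor (h' : ℝ → ℝ) : ℕ → ℝ → ℝ
  | 0 => fun _ => 1
  | n + 1 => fun x =>
      (-(n : ℝ) + -1 * h' x) * derivFactor h' n x + -1 * deriv (derivFactor h' n) x

theorem hasFlatLimit_derivFactor {h' : ℝ → ℝ} (hh : HasFlatLimit h' p) (n : ℕ) :
    HasFlatLimit (derivFactor h' n) (∏ i ∈ Finset.range n, -(p + i)) := by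
  induction n with
  | zero => simpa [derivFactor] using HasFlatLimit.const 1
  | succ n ih =>
    have := (((HasFlatLimit.const (-(n : ℝ))).add ((HasFlatLimit.const (-1)).mul hh)).mul ih).add
      ((HasFlatLimit.const (-1)).mul ih.deriv)
    have e : ∏ i ∈ Finset.range (n + 1), -(p + (i : ℝ)) =
        (-(n : ℝ) + -1 * p) * ∏ i ∈ Finset.range n, -(p + (i : ℝ)) + -1 * 0 := by
      rw [Finset.prod_range_succ]; ring
    rw [e]
    exact this

theorem eventually_iteratedDeriv_eq_of_smoothlyVarying (hf : SmoothlyVarying f p)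
    (hg : ∀ t : ℝ, 0 < t → g t = f t⁻¹) (n : ℕ) :
    ∀ᶠ t in 𝓝[>] (0 : ℝ), iteratedDeriv n g t =
      g t / t ^ n * derivFactor (deriv fun x => Real.log (f (Real.exp x))) n (-Real.log t) := by
  set h : ℝ → ℝ := fun x => Real.log (f (Real.exp x)) with hh
  induction n with
  | zero => simp [derivFactor]
  | succ n ih =>
    have h1 := eventually_eventually_nhdsWithin.2 ih
    have h2 := eventually_eventually_nhdsWithin.2 (eventually_eq_exp_of_smoothlyVarying hf hg)
    have h3 := tendsto_neg_log_nhdsGT_zero.eventually hf.eventually_pos_contDiffAt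
    have h4 := tendsto_neg_log_nhdsGT_zero.eventually
      (hasFlatLimit_derivFactor hf.hasFlatLimit_deriv n).1
    filter_upwards [h1, h2, h3, h4, self_mem_nhdsWithin] with t h1 h2 h3 h4 ht
    rw [isOpen_Ioi.nhdsWithin_eq ht] at h1 h2
    have ht' : t ≠ 0 := ne_of_gt ht
    have hlog : HasDerivAt (fun t => -Real.log t) (-t⁻¹) t := (Real.hasDerivAt_log ht').neg
    have hdh : HasDerivAt h (deriv h (-Real.log t)) (-Real.log t) :=
      (h3.2.differentiableAt (by simp)).hasDerivAt
    have hdg : HasDerivAt g (g t * (deriv h (-Real.log t) * -t⁻¹)) t := by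
      have := (hdh.comp t hlog).exp
      rw [h2.self_of_nhds]
      exact this.congr_of_eventuallyEq h2
    have hdu := (h4.differentiableAt (by simp)).hasDerivAt.comp t hlog
    have key := (hdg.div (hasDerivAt_pow n t) (pow_ne_zero n ht')).mul hdu
    rw [iteratedDeriv_succ, EventuallyEq.deriv_eq h1]
    refine key.deriv.trans ?_
    simp only [derivFactor, Function.comp, Pi.div_apply, ← hh]
    rcases n with _ | n
    · simp
      field_simp
    · simp only [Nat.add_sub_cancel]
      push_cast
      field_simp
      ring

theorem tendsto_iteratedDeriv_div_of_smoothlyVarying (hf : SmoothlyVarying f p)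
    (hg : ∀ t : ℝ, 0 < t → g t = f t⁻¹) (n : ℕ) :
    Tendsto (fun t => iteratedDeriv n g t / (g t / t ^ n)) (𝓝[>] 0)
      (𝓝 (∏ i ∈ Finset.range n, -(p + i))) := by
  refine ((hasFlatLimit_derivFactor hf.hasFlatLimit_deriv n).tendsto.comp
    tendsto_neg_log_nhdsGT_zero).congr' ?_
  filter_upwards [eventually_iteratedDeriv_eq_of_smoothlyVarying hf hg n,
    eventually_pos_of_smoothlyVarying hf hg, self_mem_nhdsWithin] with t h1 h2 h3
  have : g t / t ^ n ≠ 0 := (div_pos h2 (pow_pos h3 n)).ne'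
  rw [h1, mul_div_cancel_left₀ _ this]
  rfl

end Inversion

/-! ### Differentiating asymptotics under monotonicity -/

/-- The monotone density theorem: if `k` varies regularly at `0` with index `-q`, then
`G ~ c k` may be differentiated provided that `G'` is monotone. Indeed `G' t` lies between the
difference quotients of `G` over `[b t, t]` and `[t, a t]`, `b < 1 < a`, which are controlled
by `k`; then `a, b → 1`. -/
theorem tendsto_mul_deriv_div_of_monotoneOn {G G' k : ℝ → ℝ} {c q : ℝ}
    (hG : ∀ t, 0 < t → HasDerivAt G (G' t) t) (hmono : MonotoneOn G' (Ioi 0))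
    (hk : ∀ᶠ t in 𝓝[>] 0, 0 < k t)
    (hreg : ∀ a : ℝ, 0 < a → Tendsto (fun t => k (a * t) / k t) (𝓝[>] 0) (𝓝 (a ^ (-q))))
    (hlim : Tendsto (fun t => G t / k t) (𝓝[>] 0) (𝓝 c)) :
    Tendsto (fun t => t * G' t / k t) (𝓝[>] 0) (𝓝 (-q * c)) := by
  have hquot : ∀ a : ℝ, 0 < a → Tendsto (fun t => (G (a * t) - G t) / k t / (a - 1)) (𝓝[>] 0)
      (𝓝 ((c * a ^ (-q) - c) / (a - 1))) := by
    intro a ha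
    refine (((((hlim.comp (tendsto_mul_nhdsGT_zero ha)).mul (hreg a ha)).sub hlim)).div_const
      (a - 1)).congr' ?_
    filter_upwards [hk, (tendsto_mul_nhdsGT_zero ha).eventually hk] with t h1 h2
    simp only [Function.comp]
    field_simp
  have hslope : Tendsto (fun a : ℝ => (c * a ^ (-q) - c) / (a - 1)) (𝓝[≠] 1) (𝓝 (-q * c)) := by
    have h1 : HasDerivAt (fun a : ℝ => c * a ^ (-q)) (c * (-q * 1 ^ (-q - 1))) 1 :=
      (Real.hasDerivAt_rpow_const (Or.inl one_ne_zero)).const_mul c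
    rw [hasDerivAt_iff_tendsto_slope, Real.one_rpow, mul_one, mul_comm c] at h1
    refine h1.congr fun a => ?_
    simp [slope_def_field]
  have hmvt : ∀ a b : ℝ, 0 < a → a < b → ∃ ξ ∈ Ioo a b, G' ξ = (G b - G a) / (b - a) := by
    intro a b ha hab
    exact exists_hasDerivAt_eq_slope G G' hab
      (fun x hx => (hG x (ha.trans_le hx.1)).continuousAt.continuousWithinAt)
      (fun x hx => hG x (ha.trans hx.1))
  rw [tendsto_order]
  constructor
  · intro b hb
    have h1 : Tendsto (fun a : ℝ => (c * a ^ (-q) - c) / (a - 1)) (𝓝[<] 1) (𝓝 (-q * c)) :=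
      hslope.mono_left (nhdsWithin_mono _ fun x hx => ne_of_lt hx)
    obtain ⟨a, hab, ha0, ha1⟩ := ((h1.eventually_const_lt hb).and
      (Ioo_mem_nhdsLT (zero_lt_one (α := ℝ)))).exists
    filter_upwards [(hquot a ha0).eventually_const_lt hab, hk, self_mem_nhdsWithin]
      with t h2 h3 (h4 : 0 < t)
    refine h2.trans_le ?_
    obtain ⟨ξ, hξ, e⟩ := hmvt (a * t) t (by positivity) (by nlinarith)
    have h5 : G' ξ ≤ G' t := hmono ((mul_pos ha0 h4).trans hξ.1) h4 hξ.2.le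
    rw [e, div_le_iff₀ (by nlinarith)] at h5
    rw [div_div, div_le_iff_of_neg (mul_neg_of_pos_of_neg h3 (by linarith))]
    have e2 : t * G' t / k t * (k t * (a - 1)) = -(G' t * (t - a * t)) := by
      field_simp; ring
    rw [e2]
    linarith
  · intro b hb
    have h1 : Tendsto (fun a : ℝ => (c * a ^ (-q) - c) / (a - 1)) (𝓝[>] 1) (𝓝 (-q * c)) :=
      hslope.mono_left (nhdsWithin_mono _ fun x hx => ne_of_gt hx)
    obtain ⟨a, hab, ha1⟩ := ((h1.eventually_lt_const hb).and self_mem_nhdsWithin).exists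
    have ha1' : 1 < a := ha1
    have ha0 : 0 < a := by linarith
    filter_upwards [(hquot a ha0).eventually_lt_const hab, hk, self_mem_nhdsWithin]
      with t h2 h3 (h4 : 0 < t)
    refine lt_of_le_of_lt ?_ h2
    obtain ⟨ξ, hξ, e⟩ := hmvt t (a * t) h4 (by nlinarith)
    have h5 : G' t ≤ G' ξ := hmono h4 (h4.trans hξ.1) hξ.1.le
    rw [e, le_div_iff₀ (by nlinarith)] at h5
    rw [div_div, le_div_iff₀ (mul_pos h3 (by linarith))]
    have e2 : t * G' t / k t * (k t * (a - 1)) = G' t * (a * t - t) := by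
      field_simp
    rw [e2]
    linarith

section Asymptotics

variable {ι : Type*} {w ℓ : ι → ℝ} {f g : ℝ → ℝ} {p : ℝ}

/-- The asymptotics `∑ w exp (-ℓ t) ~ g t` may be differentiated any number of times. -/
theorem tendsto_dirichletDeriv_div (hw : ∀ i, 0 ≤ w i) (hℓ : ∀ i, 0 ≤ ℓ i)
    (hsum : ∀ t : ℝ, 0 < t → Summable fun i => w i * Real.exp (-ℓ i * t))
    (hf : SmoothlyVarying f p) (hg : ∀ t : ℝ, 0 < t → g t = f t⁻¹)
    (hlim : Tendsto (fun t => dirichletDeriv w ℓ 0 t / g t) (𝓝[>] 0) (𝓝 1)) (n : ℕ) :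
    Tendsto (fun t => dirichletDeriv w ℓ n t / (g t / t ^ n)) (𝓝[>] 0)
      (𝓝 (∏ i ∈ Finset.range n, -(p + i))) := by
  induction n with
  | zero => simpa using hlim
  | succ n ih =>
    have hsq : (-1 : ℝ) ^ n * (-1) ^ n = 1 := by rw [← mul_pow]; simp
    have hk : ∀ᶠ t in 𝓝[>] (0 : ℝ), 0 < g t / t ^ n := by
      filter_upwards [eventually_pos_of_smoothlyVarying hf hg, self_mem_nhdsWithin] with t h1 h2
      exact div_pos h1 (pow_pos h2 n)
    have hreg : ∀ a : ℝ, 0 < a → Tendsto (fun t => g (a * t) / (a * t) ^ n / (g t / t ^ n))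
        (𝓝[>] 0) (𝓝 (a ^ (-(p + n)))) := by
      intro a ha
      have e : a ^ (-(p + n)) = a ^ (-p) / a ^ n := by
        rw [neg_add, ← sub_eq_add_neg, Real.rpow_sub ha, Real.rpow_natCast]
      rw [e]
      refine ((tendsto_div_of_smoothlyVarying hf hg ha).div_const (a ^ n)).congr' ?_
      filter_upwards [eventually_pos_of_smoothlyVarying hf hg, self_mem_nhdsWithin]
        with t h1 (h2 : 0 < t)
      rw [mul_pow]
      field_simp
    have h1 := tendsto_mul_deriv_div_of_monotoneOn
      (fun t ht => (hasDerivAt_dirichletDeriv hw hℓ hsum ht n).const_mul ((-1) ^ n))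
      (monotoneOn_neg_one_pow_mul_dirichletDeriv hw hℓ hsum n) hk hreg
      ((ih.const_mul ((-1) ^ n)).congr fun t => by ring)
    have h2 := h1.const_mul ((-1) ^ n)
    rw [Finset.prod_range_succ]
    convert h2.congr' ?_ using 2
    · linear_combination (-((∏ i ∈ Finset.range n, -(p + i)) * -(p + n))) * hsq
    · filter_upwards [eventually_pos_of_smoothlyVarying hf hg, self_mem_nhdsWithin]
        with t h1 (h2 : 0 < t)
      have e : (-1) ^ n * (t * ((-1) ^ n * dirichletDeriv w ℓ (n + 1) t) / (g t / t ^ n)) =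
          ((-1) ^ n * (-1) ^ n) * (t * dirichletDeriv w ℓ (n + 1) t / (g t / t ^ n)) := by ring
      rw [e, hsq, one_mul]
      field_simp
      ring

theorem isBigO_dirichletDeriv (hw : ∀ i, 0 ≤ w i) (hℓ : ∀ i, 0 ≤ ℓ i)
    (hsum : ∀ t : ℝ, 0 < t → Summable fun i => w i * Real.exp (-ℓ i * t))
    (hf : SmoothlyVarying f p) (hg : ∀ t : ℝ, 0 < t → g t = f t⁻¹)
    (hO : dirichletDeriv w ℓ 0 =O[𝓝[>] 0] g) (n : ℕ) :
    dirichletDeriv w ℓ n =O[𝓝[>] 0] fun t => g t / t ^ n := by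
  have hhalf := tendsto_mul_nhdsGT_zero (a := 1 / 2) (by norm_num)
  have h1 : (fun t => g (1 / 2 * t)) =O[𝓝[>] 0] g := by
    refine isBigO_of_div_tendsto_nhds ?_ _ (tendsto_div_of_smoothlyVarying hf hg (by norm_num))
    filter_upwards [eventually_pos_of_smoothlyVarying hf hg] with t ht h using absurd h ht.ne'
  have h2 : (fun t => dirichletDeriv w ℓ 0 (1 / 2 * t)) =O[𝓝[>] 0] g :=
    (hO.comp_tendsto hhalf).trans h1
  have h3 : dirichletDeriv w ℓ n =O[𝓝[>] 0]
      fun t => dirichletDeriv w ℓ 0 (1 / 2 * t) * (t ^ n)⁻¹ := by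
    refine IsBigO.of_bound (n.factorial * 2 ^ n) ?_
    filter_upwards [self_mem_nhdsWithin] with t (ht : 0 < t)
    have h4 := abs_dirichletDeriv_le hw hℓ hsum ht n
    rw [Real.norm_eq_abs]
    refine h4.trans ?_
    rw [norm_mul, norm_inv, Real.norm_of_nonneg (pow_pos ht n).le, div_pow,
      show t / 2 = 1 / 2 * t by ring]
    calc _ ≤ n.factorial * (2 ^ n / t ^ n) * ‖dirichletDeriv w ℓ 0 (1 / 2 * t)‖ := by
          gcongr; exact le_abs_self _
      _ = _ := by ring
  simpa [div_eq_mul_inv] using h3.trans (h2.mul (isBigO_refl (fun t : ℝ => (t ^ n)⁻¹) (𝓝[>] 0)))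

end Asymptotics

theorem theorem4p15 {H : Type*} [NormedAddCommGroup H] [InnerProductSpace ℂ H] [CompleteSpace H]
    (X : H →ₗ.[ℂ] H) (U : ℝ → H →L[ℂ] H)
    (hU : IsGibbsSemigroup U) (hbdd : IsBoundedSemigroup U) (hgen : IsGenerator X U)
    (hsa : IsSelfAdjoint X) (hpos : ∀ x : X.domain, 0 ≤ (⟪X x, (x : H)⟫_ℂ).re)
    (F : ℝ → ℝ) (hF : ∀ t : ℝ, 0 < t → F t = traceNorm (U t))
    (f : ℝ → ℝ) (p : ℝ) (hp : 0 < p) (hf : SmoothlyVarying f p)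
    (g : ℝ → ℝ) (hg : ∀ t : ℝ, 0 < t → g t = f t⁻¹) :
    ContDiffOn ℝ ∞ F (Set.Ioi 0) ∧
    ∀ n : ℕ,
      (∀ᶠ t in 𝓝[>] (0 : ℝ), iteratedDeriv n g t ≠ 0) ∧
      (F =O[𝓝[>] 0] g → iteratedDeriv n F =O[𝓝[>] 0] iteratedDeriv n g) ∧
      (F ~[𝓝[>] 0] g → iteratedDeriv n F ~[𝓝[>] 0] iteratedDeriv n g) := by
  obtain ⟨M, hM⟩ := hbdd
  have hC := hU.toIsC0Semigroup
  have hs : ∀ t : ℝ, 0 ≤ t → ∀ x y : H, ⟪U t x, y⟫_ℂ = ⟪x, U t y⟫_ℂ :=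
    fun t ht => hgen.inner_apply_comm hC hM hsa ht
  set w : ℝ → ℝ := fun a => generatorMultiplicity U a with hw_def
  set ℓ : ℝ → ℝ := fun a => max a 0 with hℓ_def
  have hw : ∀ a, 0 ≤ w a := fun a => Nat.cast_nonneg _
  have hℓ : ∀ a, 0 ≤ ℓ a := fun a => le_max_right _ _
  have hsum : ∀ t : ℝ, 0 < t → Summable fun a => w a * Real.exp (-ℓ a * t) := fun t ht =>
    (hU.isTraceClass t ht).summable_generatorMultiplicity hC hM hs ht
  have hFS : ∀ t : ℝ, 0 < t → F t = dirichletDeriv w ℓ 0 t := fun t ht => by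
    rw [hF t ht, traceNorm_semigroup_eq_tsum hC hM hs ht]
    simp [dirichletDeriv, hw_def, hℓ_def]
  have hFev : F =ᶠ[𝓝[>] 0] dirichletDeriv w ℓ 0 := by
    filter_upwards [self_mem_nhdsWithin] with t ht using hFS t ht
  have hFn : ∀ n, iteratedDeriv n F =ᶠ[𝓝[>] 0] dirichletDeriv w ℓ n := fun n => by
    filter_upwards [self_mem_nhdsWithin] with t ht
    exact iteratedDeriv_eq_dirichletDeriv hw hℓ hsum hFS n ht
  refine ⟨(contDiffOn_dirichletDeriv hw hℓ hsum 0).congr hFS, fun n => ?_⟩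
  have hc : (∏ i ∈ Finset.range n, -(p + i)) ≠ 0 :=
    Finset.prod_ne_zero_iff.2 fun i _ => neg_ne_zero.2 (by positivity)
  have hgn := tendsto_iteratedDeriv_div_of_smoothlyVarying hf hg n
  have hg0 : ∀ᶠ t in 𝓝[>] (0 : ℝ), g t / t ^ n ≠ 0 := by
    filter_upwards [eventually_pos_of_smoothlyVarying hf hg, self_mem_nhdsWithin] with t h1 h2
    exact (div_pos h1 (pow_pos h2 n)).ne'
  have hgn0 : ∀ᶠ t in 𝓝[>] (0 : ℝ), iteratedDeriv n g t ≠ 0 := by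
    filter_upwards [hgn.eventually_ne hc] with t ht h0
    simp [h0] at ht
  refine ⟨hgn0, fun hO => ?_, fun hE => ?_⟩
  · refine ((hFn n).trans_isBigO
      (isBigO_dirichletDeriv hw hℓ hsum hf hg (hFev.symm.trans_isBigO hO) n)).trans ?_
    exact isBigO_of_div_tendsto_nhds (hgn0.mono fun t ht h => absurd h ht) _
      ((hgn.inv₀ hc).congr fun t => inv_div _ _)
  · have hE0 : Tendsto (fun t => dirichletDeriv w ℓ 0 t / g t) (𝓝[>] 0) (𝓝 1) := by
      refine ((isEquivalent_iff_tendsto_one ?_).1 hE).congr' ?_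
      · exact (eventually_pos_of_smoothlyVarying hf hg).mono fun t ht => ht.ne'
      · filter_upwards [hFev] with t ht
        simp [ht]
    rw [isEquivalent_iff_tendsto_one hgn0]
    have h1 := (tendsto_dirichletDeriv_div hw hℓ hsum hf hg hE0 n).div hgn hc
    rw [div_self hc] at h1
    refine h1.congr' ?_
    filter_upwards [hFn n, hg0] with t ht h0
    simp only [Pi.div_apply, ht]
    exact div_div_div_cancel_right₀ h0 _ _
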